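/- Let $N\ge 1$, $1\le T\le N$, $M\ge 2$. Each of $N$ servers stores the same $M$ files $W_1,\dots,W_M$, each consisting of $L=N^M$ i.i.d. uniform symbols of a finite field $\mathbb F$. A client wants $W_\theta$, $\theta$ uniform on $\{1,\dots,M\}$; in a protocol it sends a random query $Q_l^\theta$ (depending on $\theta$ and private randomness, independent of the files) to server $l$, which returns an answer $A_l^\theta$, a string of $\mathbb F$-symbols that is a function of its query and the files. The protocol is correct if $H(W_k\mid A^{k}_{1:N},Q^{k}_{1:N})=0$ for every $k$. Its rate is $R=L\log|\mathbb F|/\mathbb E[D]$, where $D$ is the total number of downloaded bits, and its maximal leakage under $T$-collusion is $$\rho^{\mathsf{MaxL}}=\max_{|\mathcal T|=T}\log\Big(\sum_{q_{\mathcal T}}\max_{m}\Pr\big(Q^\theta_{\mathcal T}=q_{\mathcal T}\mid\theta=m\big)\Big),$$ where $Q^\theta_{\mathcal T}$ is the tuple of queries seen by the set $\mathcal T$ of servers. All logarithms are to base $2$. The Sun–Jafar $T$-collusion scheme on a set $A$ of $s\geq 2$ files with desired file $\theta\in A$: group the segments of each file, in order, into $N^s$ super-segments of $N^{M-s}$ symbols,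 and multiply the vector of super-segments of each file $k\in A$ by an independent, uniformly random invertible $N^s\times N^s$ matrix $S_k$ over $\mathbb F$. For every nonempty $B\subseteq A$, each server returns $(N-T)^{|B|-1}T^{s-|B|}$ sums, each containing one symbol of every file $k\in B$. The symbols of the desired file are distinct entries of $S_\theta W_\theta$. For $k\ne\theta$ and $B\ni k$, $\theta\notin B$, the symbols of file $k$ in the sums over $B$ and over $B\cup\{\theta\}$ together (all servers) form a codeword of an MDS code, of dimension $N(N-T)^{|B|-1}T^{s-|B|}$ and length $N/T$ times the dimension, encoding a separate block of entries of $S_kW_k$, in such a way that the first code symbols (as many as the dimension) go to the sums over $B$; the generator matrix depends only on $s$ and $|B|$. The query to a server lists the coefficients (on the super-segments) of the sums that it has to return. The protocol $\mathcal P_{T\text{-}\mathsf{WSJ}}$ with parameter a distribution $P_{M'}$ on $\{0,\dots,M-1\}$: the client draws $M'\sim P_{M'}$. If $M'=0$, a uniformly random server is asked for the whole file $W_\theta$, and the others receive the null query and answer nothing. If $M'=m'\ne0$, the client chooses $m'$ other files uniformly at random, and the Sun–Jafar $T$-collusion scheme is run on these files and $W_\theta$. **Theorem.** Let $\mathbb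 F$ be sufficiently large (depending on $N,T,M$). Then MDS codes as required exist over $\mathbb F$; and for any choice of them and any real $\rho\ge0$ there is a distribution $P_{M'}$, supported on $\{0,M-1\}$ (time-sharing of a clean download and the Sun–Jafar $T$-collusion scheme on all $M$ files), for which $\mathcal P_{T\text{-}\mathsf{WSJ}}$ is correct and satisfies $$\rho^{\mathsf{MaxL}}=\min\Big(\rho,\ \log\Big(1+\frac{T(M-1)}{N}\Big)\Big),$$ $$R=\Big(1+\Big(1-\frac{N(2^\rho-1)}{T(M-1)}\Big)_+\Big(\frac TN+\cdots+\Big(\frac TN\Big)^{M-1}\Big)\Big)^{-1},\qquad (x)_+=\max(x,0).$$ -/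

import Mathlib

open scoped ENNReal

universe u

/-! ### Conditional entropy of finitely or countably supported laws -/

/-- The conditional entropy `H(X | Y) = ∑ p(x,y) log₂ (p(y) / p(x,y))` in bits of a pair `(X, Y)`
with joint law `p`, as an element of `[0, ∞]` (every summand is nonnegative, since
`p(x,y) ≤ p(y)`). -/
noncomputable def condEntropy {α β : Type*} (p : PMF (α × β)) : ℝ≥0∞ :=
  ∑' z : α × β, p z * ENNReal.ofReal (Real.logb 2 ((p.map Prod.snd) z.2 / p z).toReal)

/-! ### Information retrieval protocols on replicated servers -/

/-- An information retrieval protocol for `N` servers, each storing the same `M` files, every file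
being a string of `L` symbols of the alphabet `𝒜`. The query tuple is drawn by the client from a
law depending only on the desired index; the answer of server `l` is a deterministic function of
its query `q` and of the stored files, namely a tuple of symbols of `𝒜` indexed by the finite set
`AnsIdx q`. -/
structure IRProtocol (N M L : ℕ) (𝒜 : Type u) where
  /-- the set of queries -/
  Query : Type u
  /-- conditional law of the query tuple given the desired index -/
  queryLaw : Fin M → PMF (Fin N → Query)
  /-- positions of the symbols in the answer to a query -/
  AnsIdx : Query → Type
  /-- an answer has finitely many symbols -/
  ansFintype : ∀ q, Fintype (AnsIdx q)
  /-- the answer of a server to a query -/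
  answer : Fin N → (q : Query) → (Fin M → Fin L → 𝒜) → (AnsIdx q → 𝒜)

namespace IRProtocol

variable {N M L : ℕ} {𝒜 : Type u}

/-- For desired index `k`: the joint law of the file `W_k` and of all queries and answers. The
symbols of all files are independent and uniform on `𝒜`, and independent of the queries. -/
noncomputable def jointLaw [Fintype 𝒜] [Nonempty 𝒜] (C : IRProtocol N M L 𝒜) (k : Fin M) :
    PMF ((Fin L → 𝒜) × (Σ q : Fin N → C.Query, ∀ l, C.AnsIdx (q l) → 𝒜)) :=
  (C.queryLaw k).bind fun q =>
    (PMF.uniformOfFintype (Fin M → Fin L → 𝒜)).map fun W =>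
      (W k, ⟨q, fun l => C.answer l (q l) W⟩)

/-- Correctness: `H(W_θ | A^θ, Q^θ) = 0` for every value of the desired index `θ`. -/
def Correct [Fintype 𝒜] [Nonempty 𝒜] (C : IRProtocol N M L 𝒜) : Prop :=
  ∀ k : Fin M, condEntropy (C.jointLaw k) = 0

/-- The length in bits of the answer to a query. -/
noncomputable def answerBits [Fintype 𝒜] (C : IRProtocol N M L 𝒜) (q : C.Query) : ℝ :=
  (@Fintype.card (C.AnsIdx q) (C.ansFintype q) : ℝ) * Real.logb 2 (Fintype.card 𝒜)

/-- The expected total download `E[D]` in bits, for `θ` uniform. -/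
noncomputable def expectedDownload [Fintype 𝒜] (C : IRProtocol N M L 𝒜) : ℝ≥0∞ :=
  ∑ k : Fin M, (M : ℝ≥0∞)⁻¹ *
    ∑' q : Fin N → C.Query, C.queryLaw k q * ENNReal.ofReal (∑ l, C.answerBits (q l))

/-- The rate `L log |𝒜| / E[D]`. -/
noncomputable def rate [Fintype 𝒜] (C : IRProtocol N M L 𝒜) : ℝ :=
  (L * Real.logb 2 (Fintype.card 𝒜)) / C.expectedDownload.toReal

/-- The maximal leakage in bits to the set `𝒯` of servers:
`log₂ ∑_{q_𝒯} max_m P(Q_𝒯 = q_𝒯 | θ = m)`. -/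
noncomputable def setMaxL (C : IRProtocol N M L 𝒜) (𝒯 : Finset (Fin N)) : ℝ :=
  Real.logb 2 (∑' q : 𝒯 → C.Query,
    ⨆ m : Fin M, ((C.queryLaw m).map fun Q (t : 𝒯) => Q t) q).toReal

/-- The maximal leakage metric under `T`-collusion: the maximum over all sets of `T` servers. -/
noncomputable def maxL (C : IRProtocol N M L 𝒜) (T : ℕ) : ℝ :=
  ⨆ 𝒯 : {𝒯 : Finset (Fin N) // 𝒯.card = T}, C.setMaxL 𝒯.1

end IRProtocol

/-! ### The Sun-Jafar scheme for `T` colluding servers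

The scheme is executed on a set `A` of `s = |A|` files, each consisting of `N ^ s` super-segments.
For every nonempty `B ⊆ A` each server returns `(N-T)^(|B|-1) T^(s-|B|)` sums involving one
(precoded) symbol of each file of `B`. -/

namespace SunJafar

/-- Number of sums over a `b`-subset of the `s` files, that each server is asked for. -/
def cnt (N T s b : ℕ) : ℕ := (N - T) ^ (b - 1) * T ^ (s - b)

/-- The sums over a given `b`-subset of the `s` files: server and number at this server. -/
abbrev Blk (N T s b : ℕ) : Type := Fin N × Fin (cnt N T s b)

/-- The sums that a server is asked for: the set `B` of files involved, and a number. -/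
abbrev Row (N T : ℕ) {M : ℕ} (A : Finset (Fin M)) : Type :=
  Σ B : {B : Finset (Fin M) // B ⊆ A ∧ B.Nonempty}, Fin (cnt N T A.card B.1.card)

/-- The places, over all servers, in which a symbol of file `k` occurs. -/
abbrev Place (N T : ℕ) {M : ℕ} (A : Finset (Fin M)) (k : Fin M) : Type :=
  Σ B : {B : Finset (Fin M) // B ⊆ A ∧ k ∈ B}, Blk N T A.card B.1.card

/-- `G` (of size length × dimension) generates an MDS code: any `dimension` rows of `G` are
linearly independent. -/
def IsMDS {F : Type*} [Field F] {m n : Type*} [Fintype n] (G : Matrix m n F) : Prop :=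
  ∀ I : Finset m, I.card = Fintype.card n → LinearIndependent F fun i : I => G i

/-- The MDS generator matrices used by the scheme when it is run on `s ≤ M` files. The matrix
`mat s b` has dimension `N (N-T)^(b-1) T^(s-b)` and length `N/T` times that. Its rows are labelled
by the sums over a set of `b` undesired files, and by the sums over these files together with the
desired file. -/
structure MDSFamily (F : Type u) [Field F] (N T M : ℕ) where
  /-- the generator matrices -/
  mat : ∀ s b : ℕ, Matrix (Blk N T s b ⊕ Blk N T s (b + 1)) (Blk N T s b) F
  /-- the MDS property -/
  mds : ∀ s b : ℕ, 1 ≤ b → b < s → s ≤ M → IsMDS (mat s b)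

theorem card_place {N T M : ℕ} (hTN : T ≤ N) {A : Finset (Fin M)} {k : Fin M} (hk : k ∈ A) :
    Fintype.card (Place N T A k) = N ^ A.card := by
  classical
  have hA : (A.erase k).card + 1 = A.card := Finset.card_erase_add_one hk
  have h1 : Fintype.card (Place N T A k)
      = ∑ B : {B : Finset (Fin M) // B ⊆ A ∧ k ∈ B}, N * cnt N T A.card B.1.card := by
    simp [Place, Blk, Fintype.card_sigma]
  have h2 : (∑ B : {B : Finset (Fin M) // B ⊆ A ∧ k ∈ B}, N * cnt N T A.card B.1.card)
      = ∑ B ∈ (A.erase k).powerset, N * ((N - T) ^ B.card * T ^ ((A.erase k).card - B.card)) := by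
    symm
    refine Finset.sum_bij (fun B hB => ⟨insert k B, ?_, Finset.mem_insert_self _ _⟩) ?_ ?_ ?_ ?_
    · exact Finset.insert_subset hk
        ((Finset.mem_powerset.1 hB).trans (Finset.erase_subset _ _))
    · intro B hB
      exact Finset.mem_univ _
    · intro B hB B' hB' h
      have hB1 : k ∉ B := fun h' => Finset.notMem_erase k A (Finset.mem_powerset.1 hB h')
      have hB2 : k ∉ B' := fun h' => Finset.notMem_erase k A (Finset.mem_powerset.1 hB' h')
      have h3 : insert k B = insert k B' := congrArg Subtype.val h
      rw [← Finset.erase_insert hB1, h3, Finset.erase_insert hB2]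
    · rintro ⟨B, hB, hkB⟩ _
      exact ⟨B.erase k, Finset.mem_powerset.2 (Finset.erase_subset_erase k hB),
        Subtype.ext (Finset.insert_erase hkB)⟩
    · intro B hB
      have hB1 : k ∉ B := fun h' => Finset.notMem_erase k A (Finset.mem_powerset.1 hB h')
      have h4 : (insert k B).card = B.card + 1 := Finset.card_insert_of_notMem hB1
      simp only [cnt, h4, ← hA, Nat.add_sub_cancel, Nat.add_sub_add_right]
  rw [h1, h2, ← Finset.mul_sum, Finset.sum_pow_mul_eq_add_pow, Nat.sub_add_cancel hTN, ← hA,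
    pow_succ, mul_comm]

/-- A fixed enumeration of the places of file `k` by the `N ^ s` rows of its precoding matrix. -/
noncomputable def rowOf {N T M : ℕ} (hTN : T ≤ N) {A : Finset (Fin M)} {k : Fin M} (hk : k ∈ A) :
    Place N T A k ≃ Fin (N ^ A.card) :=
  Fintype.equivFinOfCardEq (card_place hTN hk)

/-- The symbol of file `k` in place `(l, i)` of the sums over `B` (where `k ∈ B ⊆ A`), as the
vector of its coefficients on the `N ^ s` super-segments of file `k`, when `θ` is the desired file
and `S` is the precoding matrix of file `k`.
* If `k = θ`, it is a fresh row of `S`.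
* If `k ≠ θ`, consider the block of rows of `S` that belongs to the set `B \ {θ}` of undesired
  files and encode it by the MDS code. The first code symbols occur in the sums over `B \ {θ}`,
  the remaining ones in the sums over `B \ {θ}` together with `θ`. -/
noncomputable def coeff {F : Type u} [Field F] {N T M : ℕ} (hTN : T ≤ N) (G : MDSFamily F N T M)
    {A : Finset (Fin M)} (θ : Fin M) {k : Fin M} (B : Finset (Fin M)) (hBA : B ⊆ A) (hkB : k ∈ B)
    (S : Matrix (Fin (N ^ A.card)) (Fin (N ^ A.card)) F)
    (l : Fin N) (i : Fin (cnt N T A.card B.card)) : Fin (N ^ A.card) → F :=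
  if hkθ : k = θ then
    S (rowOf hTN (hBA hkB) ⟨⟨B, hBA, hkB⟩, l, i⟩)
  else if hθB : θ ∈ B then
    ∑ c : Blk N T A.card (B.erase θ).card,
      G.mat A.card (B.erase θ).card
          (Sum.inr (l, Fin.cast (by rw [Finset.card_erase_add_one hθB]) i)) c •
        S (rowOf hTN (hBA hkB) ⟨⟨B.erase θ, (Finset.erase_subset θ B).trans hBA,
          Finset.mem_erase.2 ⟨hkθ, hkB⟩⟩, c⟩)
  else
    ∑ c : Blk N T A.card B.card,
      G.mat A.card B.card (Sum.inl (l, i)) c •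
        S (rowOf hTN (hBA hkB) ⟨⟨B, hBA, hkB⟩, c⟩)

/-- The coefficients requested from server `l`: for each sum, each file and each super-segment. -/
noncomputable def request {F : Type u} [Field F] {N T M : ℕ} (hTN : T ≤ N)
    (G : MDSFamily F N T M) (A : Finset (Fin M)) (θ : Fin M)
    (S : Fin M → GL (Fin (N ^ A.card)) F) (l : Fin N) :
    Row N T A → Fin M → Fin (N ^ A.card) → F :=
  fun r k => if hk : k ∈ r.1.1 then
      coeff hTN G θ r.1.1 r.1.2.1 hk (S k : Matrix (Fin (N ^ A.card)) (Fin (N ^ A.card)) F) l r.2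
    else 0

/-- The `v`-th segment of the `u`-th super-segment, when the `N ^ M` segments of a file are grouped
in order into `N ^ |A|` super-segments of `N ^ (M - |A|)` segments. -/
def segment {N M : ℕ} (A : Finset (Fin M)) (u : Fin (N ^ A.card)) (v : Fin (N ^ (M - A.card))) :
    Fin (N ^ M) :=
  Fin.cast (by rw [← pow_add, Nat.add_sub_cancel' (card_finset_fin_le A)])
    (finProdFinEquiv (u, v))

end SunJafar

/-! ### The weakly private scheme: time-sharing with a clean download -/

namespace TWSJ

open SunJafar

/-- The queries: the null query `φ`, the query `#_k` for the whole file `k`, and the queries of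
the Sun-Jafar scheme on the files of a set `A`. -/
inductive Query (F : Type u) (N T M : ℕ) : Type u
  | null : Query F N T M
  | clean (k : Fin M) : Query F N T M
  | sj (A : Finset (Fin M)) (c : Row N T A → Fin M → Fin (N ^ A.card) → F) : Query F N T M

/-- Positions of the answer symbols: none, the whole file, or one super-segment for each sum. -/
abbrev AnsIdx {F : Type u} {N T M : ℕ} : Query F N T M → Type
  | .null => Empty
  | .clean _ => Fin (N ^ M)
  | .sj A _ => Row N T A × Fin (N ^ (M - A.card))

instance ansFintype {F : Type u} {N T M : ℕ} : ∀ q : Query F N T M, Fintype (AnsIdx q)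
  | .null => inferInstanceAs (Fintype Empty)
  | .clean _ => inferInstanceAs (Fintype (Fin (N ^ M)))
  | .sj A _ => inferInstanceAs (Fintype (Row N T A × Fin (N ^ (M - A.card))))

/-- The answer of a server: nothing, the whole file, or the requested linear combinations of
super-segments. -/
def answer {F : Type u} [Field F] {N T M : ℕ} :
    (q : Query F N T M) → (Fin M → Fin (N ^ M) → F) → (AnsIdx q → F)
  | .null, _ => Empty.elim
  | .clean k, W => W k
  | .sj A c, W => fun x => ∑ k : Fin M, ∑ u : Fin (N ^ A.card), c x.1 k u * W k (segment A u x.2)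

/-- Case `M' = 0`: a uniformly random server gets `#_k`, all others get `φ`. -/
noncomputable def cleanLaw (F : Type u) (N T M : ℕ) [NeZero N] (k : Fin M) :
    PMF (Fin N → Query F N T M) :=
  (PMF.uniformOfFintype (Fin N)).map fun s l => if l = s then .clean k else .null

/-- The Sun-Jafar scheme on the files of `A` with desired file `k`: the precoding matrices of the
files are independent and uniform among the invertible matrices. -/
noncomputable def sjLaw {F : Type u} [Field F] [Fintype F] [DecidableEq F] {N T M : ℕ}
    (hTN : T ≤ N) (G : MDSFamily F N T M) (A : Finset (Fin M)) (k : Fin M) :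
    PMF (Fin N → Query F N T M) :=
  (PMF.uniformOfFintype (Fin M → GL (Fin (N ^ A.card)) F)).map fun S l =>
    .sj A (request hTN G A k S l)

theorem others_nonempty {M : ℕ} (k m : Fin M) :
    (Finset.powersetCard m.val (Finset.univ.erase k)).Nonempty := by
  rw [Finset.powersetCard_nonempty, Finset.card_erase_of_mem (Finset.mem_univ k),
    Finset.card_univ, Fintype.card_fin]
  have := m.isLt
  omega

/-- The law of the query tuple for desired file `k`, when the number `M'` of additional files has
law `P`. For `M' ≠ 0` a uniformly random set of `M'` other files is chosen, and the Sun-Jafar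
scheme is executed on these files and file `k`. -/
noncomputable def queryLaw {F : Type u} [Field F] [Fintype F] [DecidableEq F] {N T M : ℕ}
    [NeZero N] (hTN : T ≤ N) (G : MDSFamily F N T M) (P : PMF (Fin M)) (k : Fin M) :
    PMF (Fin N → Query F N T M) :=
  P.bind fun m =>
    if m.val = 0 then cleanLaw F N T M k
    else
      (PMF.uniformOfFinset (Finset.powersetCard m.val (Finset.univ.erase k))
        (others_nonempty k m)).bind fun J => sjLaw hTN G (insert k J) k

/-- The protocol, with file size `N ^ M`. -/
noncomputable def protocol {F : Type u} [Field F] [Fintype F] [DecidableEq F] {N T M : ℕ}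
    [NeZero N] (hTN : T ≤ N) (G : MDSFamily F N T M) (P : PMF (Fin M)) :
    IRProtocol N M (N ^ M) F where
  Query := Query F N T M
  queryLaw := queryLaw hTN G P
  AnsIdx := AnsIdx
  ansFintype := ansFintype
  answer := fun _ q W => answer q W

end TWSJ

/-! ### Probability mass functions -/

/-! Let `M'` be `M - 1` with probability `p` and `0` otherwise, and put `a = T(M-1)/N`. Everything
is affine in `p`, so it suffices to understand the two pure schemes.

Sun–Jafar decodes because all undesired files of a set `B` are encoded by the same matrix: the sums
over `B` are the first symbols of one codeword, which they determine, and the remaining symbols are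
the interference in the sums over `B ∪ {θ}` (`eq_zero_of_request`). It is private because `T`
servers see exactly as many symbols of each codeword as its dimension. By the MDS property their
coefficient vectors are independent, so they are distinct rows of `E * S_k` with `E` invertible
(`exists_coeff_eq_mul`). As `E * S_k` is again uniform, the law of the view is the same for every
`θ` (`sjLaw_map_restrict`). Its download is `N^M (1 + T/N + ... + (T/N)^(M-1))` symbols, by
`card_row`.

A clean download costs `N^M` symbols. It shows `T` servers nothing with probability `1 - T/N` and
otherwise reveals `θ`, so its sum of maxima is `(1 - T/N) + M T/N = 1 + a` (`tsum_iSup_cleanLaw`).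
The private part does not depend on `θ` and leaves the maximum, so the mixture has leakage `log(1 +
(1-p) a)`. Solving for leakage `ρ`, truncated at `p = 0`, gives the theorem. -/

theorem PMF.map_equiv_uniformOfFintype {α : Type*} [Fintype α] [Nonempty α] (e : α ≃ α) :
    (PMF.uniformOfFintype α).map e = PMF.uniformOfFintype α := by
  classical
  ext a
  rw [PMF.map_apply, tsum_eq_single (e.symm a)]
  · simp
  · intro b hb
    rw [if_neg]
    rintro rfl
    simp at hb

theorem PMF.tsum_map_mul {α β : Type*} (p : PMF α) (f : α → β) (g : β → ℝ≥0∞) :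
    ∑' b, p.map f b * g b = ∑' a, p a * g (f a) := by
  classical
  simp_rw [PMF.map_apply, ← ENNReal.tsum_mul_right]
  rw [ENNReal.tsum_comm]
  refine tsum_congr fun a => ?_
  rw [tsum_eq_single (f a)]
  · simp
  · intro b hb
    simp [hb]

theorem PMF.tsum_map_mul_of_const {α β : Type*} (p : PMF α) (f : α → β) (g : β → ℝ≥0∞) (c : ℝ≥0∞)
    (h : ∀ a, g (f a) = c) : ∑' b, p.map f b * g b = c := by
  rw [PMF.tsum_map_mul]
  simp_rw [h]
  rw [ENNReal.tsum_mul_right, PMF.tsum_coe, one_mul]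

/-- Where the mass is positive, `b` has a single partner `a`, so the marginal at `b` equals `p (a,
b)` and the logarithm is that of `1`. -/
theorem condEntropy_eq_zero {α β : Type*} (p : PMF (α × β))
    (h : ∀ a a' b, (a, b) ∈ p.support → (a', b) ∈ p.support → a = a') : condEntropy p = 0 := by
  classical
  unfold condEntropy
  rw [ENNReal.tsum_eq_zero]
  rintro ⟨a, b⟩
  by_cases hz : p (a, b) = 0
  · simp [hz]
  have key : p.map Prod.snd b = p (a, b) := by
    rw [PMF.map_apply, tsum_eq_single (a, b)]
    · simp
    · rintro ⟨a', b'⟩ hne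
      by_cases hb : b = b'
      · subst hb
        rw [if_pos rfl]
        by_contra h0
        exact hne (by rw [h a a' b hz h0])
      · simp [hb]
  simp only [key]
  rw [ENNReal.div_self hz (PMF.apply_ne_top _ _)]
  simp

/-- Applied to query patterns that reveal the desired file: for these the maximum over files is a
sum, which can be interchanged with the sum over patterns. -/
theorem iSup_eq_sum_of_pairwise {ι : Type*} [Fintype ι] (f : ι → ℝ≥0∞)
    (h : ∀ i j, f i ≠ 0 → f j ≠ 0 → i = j) : ⨆ i, f i = ∑ i, f i := by
  classical
  apply le_antisymm
  · exact iSup_le fun i => Finset.single_le_sum (fun _ _ => zero_le) (Finset.mem_univ i)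
  · by_cases hz : ∃ i, f i ≠ 0
    · obtain ⟨i, hi⟩ := hz
      rw [Finset.sum_eq_single i]
      · exact le_iSup f i
      · intro j _ hj
        by_contra h0
        exact hj (h j i h0 hi)
      · simp
    · push Not at hz
      simp [hz]

/-! ### Linear algebra -/

theorem Module.Basis.sumExtend_inl {ι K V : Type*} [DivisionRing K] [AddCommGroup V] [Module K V]
    {v : ι → V} (hs : LinearIndependent K v) (i : ι) :
    Module.Basis.sumExtend hs (Sum.inl i) = v i := by
  simp [Module.Basis.sumExtend]
  rfl

/-- Linearly independent vectors can be prescribed as rows of an invertible matrix. -/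
theorem exists_GL_rows {n ι F : Type*} [Fintype n] [DecidableEq n] [Field F] (f : ι → n)
    (hf : Function.Injective f) (e : ι → n → F) (he : LinearIndependent F e) :
    ∃ E : GL n F, ∀ i, (E : Matrix n n F) (f i) = e i := by
  classical
  let b := Module.Basis.sumExtend he
  let g := b.indexEquiv (Pi.basisFun F n)
  have : Fintype (ι ⊕ Module.Basis.sumExtendIndex he) := Fintype.ofEquiv n g.symm
  -- The basis extending `e` has as many vectors as there are rows; the injection `f` extends to a
  -- bijection between the two index sets. The values given on `inr` play no role.
  obtain ⟨h, hh⟩ := Set.MapsTo.exists_equiv_extend_of_card_eq (t := (Finset.univ : Finset n))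
    (by rw [Finset.card_univ]; exact Fintype.card_congr g)
    (s := Set.range (Sum.inl : ι → ι ⊕ Module.Basis.sumExtendIndex he))
    (f := Sum.elim f fun y => g (Sum.inr y)) (fun _ _ => by simp)
    (by
      rintro _ ⟨i, rfl⟩ _ ⟨j, rfl⟩ hij
      exact congrArg Sum.inl (hf hij))
  let h' : (ι ⊕ Module.Basis.sumExtendIndex he) ≃ n := h.trans (Equiv.subtypeUnivEquiv (by simp))
  have h'_inl (i : ι) : h' (Sum.inl i) = f i := hh _ ⟨i, rfl⟩
  let A : Matrix n n F := Matrix.of fun r => b (h'.symm r)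
  have hA : IsUnit A := by
    rw [← Matrix.linearIndependent_rows_iff_isUnit]
    exact b.linearIndependent.comp _ h'.symm.injective
  refine ⟨hA.unit, fun i => ?_⟩
  change b (h'.symm (f i)) = e i
  rw [← h'_inl, Equiv.symm_apply_apply, Module.Basis.sumExtend_inl]

/-- The Reed-Solomon code: a Vandermonde matrix with distinct nodes generates an MDS code. -/
theorem exists_isMDS {F : Type*} [Field F] [Fintype F] {m n : Type*} [Fintype m] [Fintype n]
    (h : Fintype.card m ≤ Fintype.card F) : ∃ G : Matrix m n F, SunJafar.IsMDS G := by
  classical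
  obtain ⟨α⟩ := Function.Embedding.nonempty_of_card_le h
  let e := Fintype.equivFin n
  refine ⟨Matrix.of fun i c => α i ^ (e c : ℕ), fun I hI => ?_⟩
  let d : I ≃ Fin (Fintype.card n) := Fintype.equivFinOfCardEq (by simpa using hI)
  have hu : IsUnit (Matrix.vandermonde fun j => α (d.symm j : m)) := by
    rw [Matrix.isUnit_iff_isUnit_det, isUnit_iff_ne_zero, Matrix.det_vandermonde_ne_zero_iff]
    intro i j hij
    exact d.symm.injective (Subtype.ext (α.injective hij))
  have hrow := Matrix.linearIndependent_rows_iff_isUnit.2 hu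
  have hcol := (hrow.comp d d.injective).map' (LinearMap.funLeft F F e)
    (LinearMap.ker_eq_bot.2 (LinearMap.funLeft_injective_of_surjective F F e e.surjective))
  have hfun : (fun (i : I) (c : n) => α i ^ (e c : ℕ)) = LinearMap.funLeft F F e ∘
      (Matrix.vandermonde fun j => α (d.symm j : m)).row ∘ d := by
    ext i c
    simp [Matrix.vandermonde, LinearMap.funLeft]
  change LinearIndependent F fun (i : I) (c : n) => α i ^ (e c : ℕ)
  rw [hfun]
  exact hcol

theorem exists_card_imp_nonempty_MDSFamily (N T M : ℕ) :
    ∃ q₀ : ℕ, ∀ (F : Type u) [Field F] [Fintype F], q₀ ≤ Fintype.card F →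
      Nonempty (SunJafar.MDSFamily F N T M) := by
  classical
  -- The sum of all code lengths bounds each of them, so the field has enough distinct nodes for
  -- every code.
  refine ⟨∑ s ∈ Finset.range (M + 1), ∑ b ∈ Finset.range (M + 1),
    Fintype.card (SunJafar.Blk N T s b ⊕ SunJafar.Blk N T s (b + 1)), fun F _ _ hF => ?_⟩
  have h (s b : ℕ) : ∃ G : Matrix (SunJafar.Blk N T s b ⊕ SunJafar.Blk N T s (b + 1))
      (SunJafar.Blk N T s b) F, 1 ≤ b → b < s → s ≤ M → SunJafar.IsMDS G := by
    by_cases hsb : b < s ∧ s ≤ M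
    · obtain ⟨G, hG⟩ := exists_isMDS (F := F)
        (m := SunJafar.Blk N T s b ⊕ SunJafar.Blk N T s (b + 1)) (n := SunJafar.Blk N T s b)
        (le_trans (le_trans
          (Finset.single_le_sum (f := fun b => Fintype.card
            (SunJafar.Blk N T s b ⊕ SunJafar.Blk N T s (b + 1))) (fun _ _ => Nat.zero_le _)
            (Finset.mem_range.2 (by omega : b < M + 1)))
          (Finset.single_le_sum (f := fun s => ∑ b ∈ Finset.range (M + 1), Fintype.card
            (SunJafar.Blk N T s b ⊕ SunJafar.Blk N T s (b + 1))) (fun _ _ => Nat.zero_le _)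
            (Finset.mem_range.2 (by omega : s < M + 1)))) hF)
      exact ⟨G, fun _ _ _ => hG⟩
    · exact ⟨0, fun _ h2 h3 => absurd ⟨h2, h3⟩ hsb⟩
  choose G hG using h
  exact ⟨⟨G, hG⟩⟩

namespace SunJafar

variable {F : Type u} [Field F] {N T M : ℕ} (hTN : T ≤ N) (G : MDSFamily F N T M)

/-! ### The coefficients of the sums -/

theorem coeff_desired {A : Finset (Fin M)} (θ : Fin M) (B : Finset (Fin M))
    (hBA : B ⊆ A) (hθB : θ ∈ B) (S : Matrix (Fin (N ^ A.card)) (Fin (N ^ A.card)) F)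
    (l : Fin N) (i : Fin (cnt N T A.card B.card)) :
    coeff hTN G θ B hBA hθB S l i = S (rowOf hTN (hBA hθB) ⟨⟨B, hBA, hθB⟩, l, i⟩) := by
  simp [coeff]

theorem coeff_of_notMem {A : Finset (Fin M)} {θ k : Fin M} {B : Finset (Fin M)} (hθB : θ ∉ B)
    (hBA : B ⊆ A) (hkB : k ∈ B) (S : Matrix (Fin (N ^ A.card)) (Fin (N ^ A.card)) F)
    (l : Fin N) (i : Fin (cnt N T A.card B.card)) :
    coeff hTN G θ B hBA hkB S l i = ∑ c : Blk N T A.card B.card,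
      G.mat A.card B.card (Sum.inl (l, i)) c • S (rowOf hTN (hBA hkB) ⟨⟨B, hBA, hkB⟩, c⟩) := by
  rw [coeff, dif_neg (by rintro rfl; exact hθB hkB), dif_neg hθB]

theorem coeff_insert {A : Finset (Fin M)} {θ k : Fin M} {B : Finset (Fin M)} (hθB : θ ∉ B)
    (hBA : insert θ B ⊆ A) (hBA' : B ⊆ A) (hkB : k ∈ insert θ B) (hkB' : k ∈ B)
    (S : Matrix (Fin (N ^ A.card)) (Fin (N ^ A.card)) F)
    (l : Fin N) (i : Fin (cnt N T A.card (insert θ B).card)) :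
    coeff hTN G θ (insert θ B) hBA hkB S l i = ∑ c : Blk N T A.card B.card,
      G.mat A.card B.card
          (Sum.inr (l, Fin.cast (by rw [Finset.card_insert_of_notMem hθB]) i)) c •
        S (rowOf hTN (hBA' hkB') ⟨⟨B, hBA', hkB'⟩, c⟩) := by
  -- `coeff` involves `(insert θ B).erase θ`, on which the index types depend; with both sets as
  -- variables, their equality can be eliminated.
  have key : ∀ (B₁ B₂ : Finset (Fin M)) (_ : B₁ = B₂) (h₁ : B₁ ⊆ A ∧ k ∈ B₁) (h₂ : B₂ ⊆ A ∧ k ∈ B₂)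
      (j₁ : Fin (cnt N T A.card (B₁.card + 1))) (j₂ : Fin (cnt N T A.card (B₂.card + 1)))
      (_ : (j₁ : ℕ) = j₂),
      (∑ c : Blk N T A.card B₁.card, G.mat A.card B₁.card (Sum.inr (l, j₁)) c •
        S (rowOf hTN (hBA' hkB') ⟨⟨B₁, h₁⟩, c⟩)) =
      ∑ c : Blk N T A.card B₂.card, G.mat A.card B₂.card (Sum.inr (l, j₂)) c •
        S (rowOf hTN (hBA' hkB') ⟨⟨B₂, h₂⟩, c⟩) := by
    rintro B₁ _ rfl h₁ h₂ j₁ j₂ hj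
    rw [Fin.ext hj]
  rw [coeff, dif_neg (by rintro rfl; exact hθB hkB'), dif_pos (Finset.mem_insert_self θ B)]
  exact key _ _ (Finset.erase_insert hθB) _ _ _ _ rfl

/-- The combination of rows of `S` does not depend on `S`, so it can be read off at `S = 1`. This
reduces privacy to a statement about the identity matrix. -/
theorem coeff_eq_vecMul {A : Finset (Fin M)} (θ : Fin M) {k : Fin M} (B : Finset (Fin M))
    (hBA : B ⊆ A) (hkB : k ∈ B) (S : Matrix (Fin (N ^ A.card)) (Fin (N ^ A.card)) F)
    (l : Fin N) (i : Fin (cnt N T A.card B.card)) :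
    coeff hTN G θ B hBA hkB S l i = Matrix.vecMul (coeff hTN G θ B hBA hkB 1 l i) S := by
  have h1 (r : Fin (N ^ A.card)) :
      Matrix.vecMul ((1 : Matrix (Fin (N ^ A.card)) (Fin (N ^ A.card)) F) r) S = S r := by
    ext u
    simp [Matrix.vecMul, dotProduct, Matrix.one_apply]
  unfold coeff
  split_ifs
  · exact (h1 _).symm
  all_goals simp only [Matrix.sum_vecMul, Matrix.smul_vecMul, h1]

theorem request_of_mem (A : Finset (Fin M)) (θ : Fin M) (S : Fin M → GL (Fin (N ^ A.card)) F)
    (l : Fin N) (r : Row N T A) {k : Fin M} (hk : k ∈ r.1.1) :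
    request hTN G A θ S l r k = coeff hTN G θ r.1.1 r.1.2.1 hk
      (S k : Matrix (Fin (N ^ A.card)) (Fin (N ^ A.card)) F) l r.2 :=
  dif_pos hk

theorem request_of_notMem (A : Finset (Fin M)) (θ : Fin M) (S : Fin M → GL (Fin (N ^ A.card)) F)
    (l : Fin N) (r : Row N T A) {k : Fin M} (hk : k ∉ r.1.1) :
    request hTN G A θ S l r k = 0 :=
  dif_neg hk

/-! ### Decodability -/

/-- The `inl` rows are as many as the dimension, so they form an invertible square matrix: the first
code symbols determine the encoded block. -/
theorem MDSFamily.eq_zero_of_inl (G : MDSFamily F N T M) {s b : ℕ} (hb : 1 ≤ b) (hbs : b < s)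
    (hs : s ≤ M) (z : Blk N T s b → F)
    (h : ∀ x, ∑ c, G.mat s b (Sum.inl x) c * z c = 0) : z = 0 := by
  classical
  let A : Matrix (Blk N T s b) (Blk N T s b) F := Matrix.of fun x => G.mat s b (Sum.inl x)
  have hlin := G.mds s b hb hbs hs (Finset.univ.map Function.Embedding.inl) (by simp)
  have hA : IsUnit A := by
    rw [← Matrix.linearIndependent_rows_iff_isUnit]
    exact hlin.comp (fun x => ⟨Sum.inl x, by simp⟩) fun x y hxy => by simpa using hxy
  refine Matrix.mulVec_injective_of_isUnit hA ?_
  ext x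
  simpa [A, Matrix.mulVec, dotProduct] using h x

/-- The requested sums determine the desired file. -/
theorem eq_zero_of_request [DecidableEq F] {A : Finset (Fin M)} {θ : Fin M} (hθA : θ ∈ A)
    (S : Fin M → GL (Fin (N ^ A.card)) F) (D : Fin M → Fin (N ^ A.card) → F)
    (h : ∀ l r, ∑ k, ∑ u, request hTN G A θ S l r k u * D k u = 0) : D θ = 0 := by
  classical
  have hsM : A.card ≤ M := card_finset_fin_le A
  -- The uncoded block of `S k` belonging to `B`, extended by zero to files outside `B` so that sums
  -- can run over all files.
  let symb (B : Finset (Fin M)) (hB : B ⊆ A) (c : Blk N T A.card B.card) (k : Fin M) :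
      Fin (N ^ A.card) → F :=
    if hk : k ∈ B then
      (S k : Matrix (Fin (N ^ A.card)) (Fin (N ^ A.card)) F) (rowOf hTN (hB hk) ⟨⟨B, hB, hk⟩, c⟩)
    else 0
  -- The code is the same for all files, so encoding commutes with summing over files: the
  -- interference is the codeword of the summed blocks.
  have hswap (B : Finset (Fin M)) (hB : B ⊆ A) (g : Blk N T A.card B.card → F) :
      ∑ k, ∑ u, (∑ c, g c • symb B hB c k) u * D k u =
        ∑ c, g c * ∑ k, ∑ u, symb B hB c k u * D k u := by
    simp only [Finset.sum_apply, Pi.smul_apply, smul_eq_mul, Finset.sum_mul, Finset.mul_sum]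
    simp only [mul_assoc]
    conv_lhs => enter [2, k]; rw [Finset.sum_comm]
    rw [Finset.sum_comm]
  -- The sums over a set without `θ` are the first symbols of that codeword; as they vanish, so does
  -- the summed block.
  have hz (B : Finset (Fin M)) (hB : B ⊆ A) (hθB : θ ∉ B) (c : Blk N T A.card B.card) :
      ∑ k, ∑ u, symb B hB c k u * D k u = 0 := by
    rcases B.eq_empty_or_nonempty with rfl | hne
    · simp [symb]
    refine congrFun (G.eq_zero_of_inl hne.card_pos
      (Finset.card_lt_card (Finset.ssubset_iff_subset_ne.2 ⟨hB, fun h => hθB (h ▸ hθA)⟩)) hsM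
      (fun c => ∑ k, ∑ u, symb B hB c k u * D k u) ?_) c
    rintro ⟨l, i⟩
    rw [← hswap, ← h l ⟨⟨B, hB, hne⟩, i⟩]
    refine Finset.sum_congr rfl fun k _ => ?_
    have hreq : request hTN G A θ S l ⟨⟨B, hB, hne⟩, i⟩ k =
        ∑ c, G.mat A.card B.card (Sum.inl (l, i)) c • symb B hB c k := by
      by_cases hk : k ∈ B
      · simp only [request, symb, hk, dif_pos]
        exact coeff_of_notMem hTN G hθB hB hk _ l i
      · simp [request, symb, hk]
    rw [hreq]
  -- A sum over `insert θ B` is a desired symbol plus a later symbol of the codeword for `B`, which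
  -- is now known to be zero.
  have hrow (p : Place N T A θ) :
      ∑ u, (S θ : Matrix (Fin (N ^ A.card)) (Fin (N ^ A.card)) F) (rowOf hTN hθA p) u * D θ u
        = 0 := by
    obtain ⟨⟨B₁, hB₁, hθB₁⟩, l, i⟩ := p
    obtain ⟨B, hθB, rfl⟩ : ∃ B, θ ∉ B ∧ insert θ B = B₁ :=
      ⟨B₁.erase θ, Finset.notMem_erase _ _, Finset.insert_erase hθB₁⟩
    have hB : B ⊆ A := (Finset.subset_insert _ _).trans hB₁
    have hsum := h l ⟨⟨insert θ B, hB₁, Finset.insert_nonempty _ _⟩, i⟩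
    have hzero := hswap B hB (G.mat A.card B.card
      (Sum.inr (l, Fin.cast (by rw [Finset.card_insert_of_notMem hθB]) i)))
    simp only [hz B hB hθB, mul_zero, Finset.sum_const_zero] at hzero
    rw [← Finset.add_sum_erase _ _ (Finset.mem_univ θ)] at hsum hzero
    have hθ0 : (∑ c, G.mat A.card B.card
        (Sum.inr (l, Fin.cast (by rw [Finset.card_insert_of_notMem hθB]) i)) c • symb B hB c θ)
          = 0 := by
      simp [symb, hθB]
    have hk0 : ∀ k ∈ Finset.univ.erase θ,
        request hTN G A θ S l ⟨⟨insert θ B, hB₁, Finset.insert_nonempty _ _⟩, i⟩ k =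
          ∑ c, G.mat A.card B.card
            (Sum.inr (l, Fin.cast (by rw [Finset.card_insert_of_notMem hθB]) i)) c •
              symb B hB c k := by
      intro k hk
      have hkθ : k ≠ θ := Finset.ne_of_mem_erase hk
      by_cases hkB : k ∈ B
      · simp only [request, symb, hkB, dif_pos, Finset.mem_insert_of_mem hkB]
        exact coeff_insert hTN G hθB hB₁ hB _ hkB _ l i
      · simp [request, symb, hkB, hkθ]
    rw [Finset.sum_congr rfl fun k hk => Finset.sum_congr rfl fun u _ =>
      congrArg (fun x => x u * D k u) (hk0 k hk)] at hsum
    rw [hθ0] at hzero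
    simp only [Pi.zero_apply, zero_mul, Finset.sum_const_zero, zero_add] at hzero
    rw [hzero, add_zero] at hsum
    simpa only [request, Finset.mem_insert_self, dif_pos, coeff_desired] using hsum
  refine Matrix.mulVec_injective_of_isUnit (S θ).isUnit ?_
  ext x
  obtain ⟨p, rfl⟩ := (rowOf hTN hθA).surjective x
  simpa [Matrix.mulVec, dotProduct] using hrow p

/-! ### Privacy -/

/-- The MDS code restricted to the servers of a `T`-set has as many symbols as its dimension. -/
theorem card_visible {s b : ℕ} (hb : 1 ≤ b) (hbs : b < s) {𝒯 : Finset (Fin N)} (h𝒯 : 𝒯.card = T) :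
    ((𝒯 ×ˢ (Finset.univ : Finset (Fin (cnt N T s b)))).disjSum
      (𝒯 ×ˢ (Finset.univ : Finset (Fin (cnt N T s (b + 1)))))).card
      = Fintype.card (Blk N T s b) := by
  obtain ⟨b, rfl⟩ := Nat.exists_eq_add_of_le' hb
  obtain ⟨d, rfl⟩ := Nat.exists_eq_add_of_lt hbs
  have hTN : T ≤ N := by simpa [h𝒯] using card_finset_fin_le 𝒯
  obtain ⟨x, rfl⟩ := Nat.exists_eq_add_of_le hTN
  have h1 : b + 1 + d + 1 - (b + 1) = d + 1 := by omega
  have h2 : b + 1 + d + 1 - (b + 1 + 1) = d := by omega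
  rw [Finset.card_disjSum, Finset.card_product, Finset.card_product, Finset.card_fin,
    Finset.card_fin, h𝒯]
  simp only [Fintype.card_fin,
    Fintype.card_prod, cnt, h1, h2, Nat.add_sub_cancel, Nat.add_sub_cancel_left]
  ring

/-- Different sets `B` without `θ` use disjoint blocks of rows, so independence can be checked block
by block. Within a block, `T` servers see exactly dimension-many rows of the MDS generator, by
`card_visible`. -/
theorem linearIndependent_coeff {A : Finset (Fin M)} {θ k : Fin M} (hθA : θ ∈ A) (hkA : k ∈ A)
    (hkθ : k ≠ θ) {𝒯 : Finset (Fin N)} (h𝒯 : 𝒯.card = T) :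
    LinearIndependent F fun p : {p : Place N T A k // p.2.1 ∈ 𝒯} =>
      coeff hTN G θ p.1.1.1 p.1.1.2.1 p.1.1.2.2 1 p.1.2.1 p.1.2.2 := by
  classical
  let J := {B : Finset (Fin M) // (B ⊆ A ∧ k ∈ B) ∧ θ ∉ B}
  let I (B : J) := {x // x ∈ (𝒯 ×ˢ (Finset.univ : Finset (Fin (cnt N T A.card B.1.card)))).disjSum
      (𝒯 ×ˢ (Finset.univ : Finset (Fin (cnt N T A.card (B.1.card + 1)))))}
  have hmds (B : J) : LinearIndependent F fun x : I B => G.mat A.card B.1.card x := by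
    have hlt : B.1.card < A.card := Finset.card_lt_card
      (Finset.ssubset_iff_subset_ne.2 ⟨B.2.1.1, fun h => B.2.2 (by rw [h]; exact hθA)⟩)
    exact G.mds A.card B.1.card (Finset.card_pos.2 ⟨k, B.2.1.2⟩) hlt (card_finset_fin_le A) _
      (card_visible (Finset.card_pos.2 ⟨k, B.2.1.2⟩) hlt h𝒯)
  -- Code position to place: `inl` lies in the sums over `B`, `inr` in those over `insert θ B`.
  -- Surjectivity suffices, since independence is later pulled back along a right inverse.
  let τ : (Σ B : J, I B) → {p : Place N T A k // p.2.1 ∈ 𝒯}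
    | ⟨B, ⟨Sum.inl (l, i), h⟩⟩ => ⟨⟨⟨B.1, B.2.1⟩, l, i⟩, by simpa using h⟩
    | ⟨B, ⟨Sum.inr (l, i), h⟩⟩ => ⟨⟨⟨insert θ B.1, Finset.insert_subset hθA B.2.1.1,
        Finset.mem_insert_of_mem B.2.1.2⟩, l,
          Fin.cast (by rw [Finset.card_insert_of_notMem B.2.2]) i⟩, by simpa using h⟩
  have hτ : Function.Surjective τ := by
    rintro ⟨⟨⟨B₁, hB₁, hkB₁⟩, l, i⟩, hl⟩
    by_cases hθ : θ ∈ B₁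
    · obtain ⟨B, hθB, rfl⟩ : ∃ B, θ ∉ B ∧ insert θ B = B₁ :=
        ⟨B₁.erase θ, Finset.notMem_erase _ _, Finset.insert_erase hθ⟩
      exact ⟨⟨⟨B, ⟨(Finset.subset_insert _ _).trans hB₁,
        Finset.mem_of_mem_insert_of_ne hkB₁ hkθ⟩, hθB⟩,
        ⟨Sum.inr (l, Fin.cast (by rw [Finset.card_insert_of_notMem hθB]) i),
          by simpa using hl⟩⟩, rfl⟩
    · exact ⟨⟨⟨B₁, ⟨hB₁, hkB₁⟩, hθ⟩, ⟨Sum.inl (l, i), by simpa using hl⟩⟩, rfl⟩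
  -- Reads a vector in block coordinates; the coefficients become rows of the generator matrices,
  -- each supported in one block.
  let Ψ : (Fin (N ^ A.card) → F) →ₗ[F] (∀ B : J, Blk N T A.card B.1.card → F) :=
    LinearMap.pi fun B => LinearMap.funLeft F F fun c => rowOf hTN hkA ⟨⟨B.1, B.2.1⟩, c⟩
  have hΨ (B B' : J) (g : Blk N T A.card B.1.card → F) :
      Ψ (∑ c, g c • (1 : Matrix (Fin (N ^ A.card)) (Fin (N ^ A.card)) F)
        (rowOf hTN hkA ⟨⟨B.1, B.2.1⟩, c⟩)) B' = (Pi.single B g : ∀ B : J, Blk N T A.card B.1.card → F) B' := by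
    ext c'
    have h1 : Ψ (∑ c, g c • (1 : Matrix (Fin (N ^ A.card)) (Fin (N ^ A.card)) F)
        (rowOf hTN hkA ⟨⟨B.1, B.2.1⟩, c⟩)) B' c' = ∑ c, g c *
          (1 : Matrix (Fin (N ^ A.card)) (Fin (N ^ A.card)) F)
        (rowOf hTN hkA ⟨⟨B.1, B.2.1⟩, c⟩) (rowOf hTN hkA ⟨⟨B'.1, B'.2.1⟩, c'⟩) := by
      simp [Ψ, LinearMap.funLeft]
    rw [h1]
    by_cases hB : B = B'
    · subst hB
      simp [Matrix.one_apply]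
    · have hB' : B.1 ≠ B'.1 := fun h => hB (Subtype.ext h)
      rw [Pi.single_eq_of_ne (Ne.symm hB)]
      simp [hB']
  have hlin := Pi.linearIndependent_single (R := F)
    (fun (B : J) (x : I B) => G.mat A.card B.1.card x) hmds
  have hcomp : LinearIndependent F fun x : Σ B : J, I B =>
      coeff hTN G θ (τ x).1.1.1 (τ x).1.1.2.1 (τ x).1.1.2.2
        (1 : Matrix (Fin (N ^ A.card)) (Fin (N ^ A.card)) F) (τ x).1.2.1 (τ x).1.2.2 := by
    refine LinearIndependent.of_comp Ψ ?_
    convert hlin using 1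
    ext1 x
    rcases x with ⟨B, ⟨⟨l, i⟩ | ⟨l, i⟩, h⟩⟩
    · change Ψ (coeff hTN G θ B.1 _ _ _ l i) = _
      rw [coeff_of_notMem hTN G B.2.2]
      exact funext fun B' => hΨ B B' _
    · change Ψ (coeff hTN G θ (insert θ B.1) _ _ _ l _) = _
      rw [coeff_insert hTN G B.2.2 _ B.2.1.1 _ B.2.1.2]
      exact funext fun B' => hΨ B B' _
  have := hcomp.comp _ (Function.injective_surjInv hτ)
  convert this using 1
  ext1 p
  simp only [Function.comp_apply]
  rw [Function.surjInv_eq hτ p]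

/-- The coefficients seen by `T` servers are distinct rows of the precoding matrix, up to
multiplication by an invertible matrix. -/
theorem exists_coeff_eq_mul {A : Finset (Fin M)} {θ k : Fin M} (hθA : θ ∈ A) (hkA : k ∈ A)
    {𝒯 : Finset (Fin N)} (h𝒯 : 𝒯.card = T) :
    ∃ E : GL (Fin (N ^ A.card)) F, ∀ (B : Finset (Fin M)) (hBA : B ⊆ A) (hkB : k ∈ B)
      (S : Matrix (Fin (N ^ A.card)) (Fin (N ^ A.card)) F), ∀ l ∈ 𝒯, ∀ i,
      coeff hTN G θ B hBA hkB S l i =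
        ((E : Matrix (Fin (N ^ A.card)) (Fin (N ^ A.card)) F) * S)
          (rowOf hTN (hBA hkB) ⟨⟨B, hBA, hkB⟩, l, i⟩) := by
  by_cases hkθ : k = θ
  · subst hkθ
    exact ⟨1, fun B hBA hkB S l _ i => by simp [coeff_desired]⟩
  -- `E` has the visible coefficient vectors for `S = 1` as its rows at their places; its other rows
  -- are arbitrary.
  · obtain ⟨E, hE⟩ := exists_GL_rows
      (fun p : {p : Place N T A k // p.2.1 ∈ 𝒯} => rowOf hTN hkA p.1)
      ((rowOf hTN hkA).injective.comp Subtype.val_injective) _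
      (linearIndependent_coeff hTN G hθA hkA hkθ h𝒯)
    refine ⟨E, fun B hBA hkB S l hl i => ?_⟩
    rw [coeff_eq_vecMul, ← hE ⟨⟨⟨B, hBA, hkB⟩, l, i⟩, hl⟩]
    rfl

end SunJafar

namespace TWSJ
open SunJafar

/-- The Sun-Jafar scheme is private against `T` colluding servers. -/
theorem sjLaw_map_restrict {F : Type u} [Field F] [Fintype F] [DecidableEq F] {N T M : ℕ}
    (hTN : T ≤ N) (G : MDSFamily F N T M) {A : Finset (Fin M)} {θ θ' : Fin M}
    (hθ : θ ∈ A) (hθ' : θ' ∈ A) {𝒯 : Finset (Fin N)} (h𝒯 : 𝒯.card = T) :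
    (sjLaw hTN G A θ).map (fun Q (t : 𝒯) => Q t) = (sjLaw hTN G A θ').map fun Q (t : 𝒯) => Q t := by
  classical
  -- A reference view without `θ`: each place shows its own row of the precoding matrix.
  let base (S : Fin M → GL (Fin (N ^ A.card)) F) (t : 𝒯) : Query F N T M :=
    .sj A fun r k => if hk : k ∈ r.1.1 then
      (S k : Matrix (Fin (N ^ A.card)) (Fin (N ^ A.card)) F)
        (rowOf hTN (r.1.2.1 hk) ⟨⟨r.1.1, r.1.2.1, hk⟩, t, r.2⟩) else 0
  suffices h : ∀ θ ∈ A, (sjLaw hTN G A θ).map (fun Q (t : 𝒯) => Q t) =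
      (PMF.uniformOfFintype (Fin M → GL (Fin (N ^ A.card)) F)).map base by
    rw [h θ hθ, h θ' hθ']
  intro θ hθ
  have hE (k : Fin M) : ∃ E : GL (Fin (N ^ A.card)) F, ∀ (B : Finset (Fin M)) (hBA : B ⊆ A)
      (hkB : k ∈ B) (S : Matrix (Fin (N ^ A.card)) (Fin (N ^ A.card)) F), ∀ l ∈ 𝒯, ∀ i,
      coeff hTN G θ B hBA hkB S l i =
        ((E : Matrix (Fin (N ^ A.card)) (Fin (N ^ A.card)) F) * S)
          (rowOf hTN (hBA hkB) ⟨⟨B, hBA, hkB⟩, l, i⟩) := by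
    by_cases hkA : k ∈ A
    · exact exists_coeff_eq_mul hTN G hθ hkA h𝒯
    · exact ⟨1, fun B hBA hkB => absurd (hBA hkB) hkA⟩
  choose E hE using hE
  rw [sjLaw, PMF.map_comp]
  -- Left multiplication by `E` permutes the tuples of invertible matrices, so it preserves their
  -- uniform law.
  conv_rhs => rw [← PMF.map_equiv_uniformOfFintype (Equiv.mulLeft E), PMF.map_comp]
  congr 1
  ext1 S
  ext1 t
  simp only [Function.comp_apply, base]
  congr 1
  ext1 r
  ext1 k
  by_cases hk : k ∈ r.1.1
  · rw [request_of_mem hTN G A θ S t r hk, dif_pos hk, hE k r.1.1 r.1.2.1 hk _ t t.2 r.2]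
    rfl
  · rw [request_of_notMem hTN G A θ S t r hk, dif_neg hk]

end TWSJ

/-! ### Counting sums and segments -/

/-- Induction on `A`: a new file multiplies the number of sums avoiding it by `T`, and the sums
containing it number `((N-T) + T)^|A| = N^|A|` by the binomial theorem. The geometric sum also
covers `N = T`. -/
theorem SunJafar.card_row {N T M : ℕ} (hTN : T ≤ N) (A : Finset (Fin M)) :
    Fintype.card (SunJafar.Row N T A)
      = ∑ i ∈ Finset.range A.card, N ^ i * T ^ (A.card - 1 - i) := by
  classical
  have h1 : Fintype.card (SunJafar.Row N T A) = ∑ B ∈ A.powerset with B.Nonempty,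
      (N - T) ^ (B.card - 1) * T ^ (A.card - B.card) := by
    rw [Fintype.card_sigma]
    refine (Finset.sum_congr rfl fun B _ => Fintype.card_fin _).trans
      (Finset.sum_subtype (p := fun B => B ⊆ A ∧ B.Nonempty) _ (fun B => ?_) fun B =>
        (N - T) ^ (B.card - 1) * T ^ (A.card - B.card)).symm
    simp
  rw [h1, Finset.sum_filter]
  clear h1
  induction A using Finset.induction_on with
  | empty => simp
  | insert a A ha ih =>
    rw [Finset.sum_powerset_insert ha, Finset.card_insert_of_notMem ha, Finset.sum_range_succ]
    have h2 : ∑ B ∈ A.powerset, (if B.Nonempty then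
        (N - T) ^ (B.card - 1) * T ^ (A.card + 1 - B.card) else 0) =
        T * ∑ B ∈ A.powerset, if B.Nonempty then
        (N - T) ^ (B.card - 1) * T ^ (A.card - B.card) else 0 := by
      rw [Finset.mul_sum]
      refine Finset.sum_congr rfl fun B hB => ?_
      split_ifs
      · rw [Nat.sub_add_comm (Finset.card_le_card (Finset.mem_powerset.1 hB))]
        ring
      · simp
    have h3 : ∑ B ∈ A.powerset, (if (insert a B).Nonempty then
        (N - T) ^ ((insert a B).card - 1) * T ^ (A.card + 1 - (insert a B).card) else 0) =
        N ^ A.card := by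
      conv_rhs => rw [← Nat.sub_add_cancel hTN, ← Finset.sum_pow_mul_eq_add_pow]
      refine Finset.sum_congr rfl fun B hB => ?_
      rw [if_pos (Finset.insert_nonempty _ _), Finset.card_insert_of_notMem
        fun h => ha (Finset.mem_powerset.1 hB h), Nat.add_sub_cancel, Nat.add_sub_add_right]
    rw [h2, h3, ih, Finset.mul_sum]
    congr 1
    · refine Finset.sum_congr rfl fun i hi => ?_
      have h4 : A.card + 1 - 1 - i = A.card - 1 - i + 1 := by
        have := Finset.mem_range.1 hi
        omega
      rw [h4]
      ring
    · simp

theorem SunJafar.exists_segment_eq {N M : ℕ} (A : Finset (Fin M)) (x : Fin (N ^ M)) :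
    ∃ u v, SunJafar.segment A u v = x := by
  have h : N ^ M = N ^ A.card * N ^ (M - A.card) := by
    rw [← pow_add, Nat.add_sub_cancel' (card_finset_fin_le A)]
  refine ⟨(finProdFinEquiv.symm (Fin.cast h x)).1, (finProdFinEquiv.symm (Fin.cast h x)).2, ?_⟩
  rw [SunJafar.segment, Prod.mk.eta, Equiv.apply_symm_apply]
  rfl

namespace TWSJ

open SunJafar

variable {F : Type u} {N T M : ℕ}

/-! ### Correctness -/

/-- Answers are linear and treat each position `v` inside the super-segments separately, so
`eq_zero_of_request` applies to the difference of the two file contents at each `v`. -/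
theorem eq_of_answer_sj [Field F] [DecidableEq F] (hTN : T ≤ N) (G : MDSFamily F N T M) {A : Finset (Fin M)} {k : Fin M}
    (hk : k ∈ A) (S : Fin M → GL (Fin (N ^ A.card)) F) (W W' : Fin M → Fin (N ^ M) → F)
    (h : ∀ l, answer (.sj A (request hTN G A k S l) : Query F N T M) W =
      answer (.sj A (request hTN G A k S l) : Query F N T M) W') : W k = W' k := by
  ext x
  obtain ⟨u, v, rfl⟩ := exists_segment_eq A x
  have hD := eq_zero_of_request hTN G hk S
    (fun k u => W k (segment A u v) - W' k (segment A u v)) fun l r => by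
      have := congrFun (h l) (r, v)
      simp only [answer] at this
      simp only [mul_sub, Finset.sum_sub_distrib]
      rw [this, sub_self]
  exact sub_eq_zero.1 (congrFun hD u)

theorem eq_of_answer [Field F] [Fintype F] [DecidableEq F] [NeZero N] (hTN : T ≤ N)
    (G : MDSFamily F N T M) (P : PMF (Fin M)) {k : Fin M} (q : Fin N → Query F N T M)
    (hq : q ∈ (queryLaw hTN G P k).support) (W W' : Fin M → Fin (N ^ M) → F)
    (hans : ∀ l, answer (q l) W = answer (q l) W') : W k = W' k := by
  rw [queryLaw, PMF.mem_support_bind_iff] at hq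
  obtain ⟨m, -, hq⟩ := hq
  split_ifs at hq with hm
  · rw [cleanLaw, PMF.mem_support_map_iff] at hq
    obtain ⟨s, -, rfl⟩ := hq
    have := hans s
    simp only at this
    rw [if_pos rfl] at this
    exact this
  · rw [PMF.mem_support_bind_iff] at hq
    obtain ⟨J, -, hq⟩ := hq
    rw [sjLaw, PMF.mem_support_map_iff] at hq
    obtain ⟨S, -, rfl⟩ := hq
    exact eq_of_answer_sj hTN G (Finset.mem_insert_self k J) S W W' hans

theorem protocol_correct [Field F] [Fintype F] [DecidableEq F] [NeZero N] (hTN : T ≤ N)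
    (G : MDSFamily F N T M) (P : PMF (Fin M)) : (protocol hTN G P).Correct := by
  intro k
  refine condEntropy_eq_zero _ fun w w' y h h' => ?_
  simp only [IRProtocol.jointLaw, PMF.mem_support_bind_iff, PMF.mem_support_map_iff,
    Prod.mk.injEq] at h h'
  obtain ⟨q, hq, W, -, rfl, rfl⟩ := h
  obtain ⟨q', -, W', -, rfl, hy⟩ := h'
  obtain ⟨rfl, hy⟩ := Sigma.mk.inj_iff.1 hy
  have hans (l : Fin N) : answer (q' l) W = answer (q' l) W' := (congrFun (eq_of_heq hy) l).symm
  exact eq_of_answer hTN G P q' hq W W' hans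

/-! ### Time-sharing of a clean download and the Sun-Jafar scheme on all files -/

theorem sum_two_point (hM : 2 ≤ M) (a b : ℝ≥0∞) (f : Fin M → ℝ≥0∞) :
    ∑ m : Fin M, (if m.val = 0 then a else if m.val = M - 1 then b else 0) * f m =
      a * f ⟨0, by omega⟩ + b * f ⟨M - 1, by omega⟩ := by
  have hM1 : M - 1 ≠ 0 := by omega
  rw [Fintype.sum_eq_add (⟨0, by omega⟩ : Fin M) ⟨M - 1, by omega⟩]
  · simp [hM1]
  · simpa [Fin.ext_iff] using hM1.symm
  · rintro m ⟨h0, h1⟩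
    rw [if_neg (fun h => h0 (Fin.ext h)), if_neg (fun h => h1 (Fin.ext h)), zero_mul]

/-- The law with mass `p` at `M - 1` and mass `1 - p` at `0`. -/
noncomputable def twoPoint (hM : 2 ≤ M) (p : ℝ≥0∞) (hp : p ≤ 1) : PMF (Fin M) :=
  PMF.ofFintype (fun m => if m.val = 0 then 1 - p else if m.val = M - 1 then p else 0) (by
    have := sum_two_point hM (1 - p) p 1
    simp only [Pi.one_apply, mul_one] at this
    rw [this, tsub_add_cancel_of_le hp])

theorem twoPoint_bind_apply {α : Type*} (hM : 2 ≤ M) (p : ℝ≥0∞) (hp : p ≤ 1) (g : Fin M → PMF α)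
    (x : α) : (twoPoint hM p hp).bind g x =
      (1 - p) * g ⟨0, by omega⟩ x + p * g ⟨M - 1, by omega⟩ x := by
  rw [PMF.bind_apply, tsum_fintype, ← sum_two_point hM (1 - p) p fun m => g m x]
  rfl

theorem twoPoint_ne_zero (hM : 2 ≤ M) (p : ℝ≥0∞) (hp : p ≤ 1) (m : Fin M)
    (h : twoPoint hM p hp m ≠ 0) : m.val = 0 ∨ m.val = M - 1 := by
  by_contra! h'
  apply h
  simp [twoPoint, h'.1, h'.2]

theorem bind_eq_of_forall_support {α β : Type*} (p : PMF α) (f : α → PMF β) (c : PMF β)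
    (h : ∀ a ∈ p.support, f a = c) : p.bind f = c := by
  ext x
  rw [PMF.bind_apply]
  calc ∑' a, p a * f a x = ∑' a, p a * c x := by
        refine tsum_congr fun a => ?_
        by_cases ha : p a = 0
        · simp [ha]
        · rw [h a ha]
    _ = c x := by rw [ENNReal.tsum_mul_right, PMF.tsum_coe, one_mul]

/-- There is only one set of `M - 1` other files. -/
theorem bind_others_eq [Field F] [Fintype F] [DecidableEq F] (hM : 2 ≤ M) (hTN : T ≤ N)
    (G : MDSFamily F N T M) (k : Fin M) :
    ((PMF.uniformOfFinset (Finset.powersetCard (M - 1) (Finset.univ.erase k))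
        (others_nonempty k ⟨M - 1, by omega⟩)).bind fun J => sjLaw hTN G (insert k J) k)
      = sjLaw hTN G Finset.univ k := by
  refine bind_eq_of_forall_support _ _ _ fun J hJ => ?_
  rw [PMF.mem_support_uniformOfFinset_iff, Finset.mem_powersetCard] at hJ
  have hJ' : J = Finset.univ.erase k := Finset.eq_of_subset_of_card_le hJ.1 (by
    rw [hJ.2, Finset.card_erase_of_mem (Finset.mem_univ k), Finset.card_univ, Fintype.card_fin])
  rw [hJ', Finset.insert_erase (Finset.mem_univ k)]

theorem queryLaw_twoPoint_map_apply [Field F] [Fintype F] [DecidableEq F] [NeZero N] {β : Type*}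
    (hM : 2 ≤ M) (hTN : T ≤ N) (G : MDSFamily F N T M) (p : ℝ≥0∞) (hp : p ≤ 1) (k : Fin M)
    (f : (Fin N → Query F N T M) → β) (x : β) :
    (queryLaw hTN G (twoPoint hM p hp) k).map f x =
      (1 - p) * (cleanLaw F N T M k).map f x + p * (sjLaw hTN G Finset.univ k).map f x := by
  have hM1 : M - 1 ≠ 0 := by omega
  rw [queryLaw, PMF.map_bind, twoPoint_bind_apply]
  simp only [if_true, hM1, if_false]
  rw [bind_others_eq hM]

/-! ### Download -/

theorem sum_card_ansIdx_clean (C : ℝ) (k : Fin M) (s : Fin N) :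
    ∑ l, (Fintype.card (AnsIdx (if l = s then .clean k else .null : Query F N T M)) : ℝ) * C =
      (N : ℝ) ^ M * C := by
  rw [Finset.sum_eq_single s]
  · rw [if_pos rfl]
    change (Fintype.card (Fin (N ^ M)) : ℝ) * C = _
    simp
  · intro l _ hl
    rw [if_neg hl]
    change (Fintype.card Empty : ℝ) * C = _
    simp
  · simp

theorem expectedDownload_twoPoint [Field F] [Fintype F] [DecidableEq F] [NeZero N]
    (hM : 2 ≤ M) (hTN : T ≤ N) (G : MDSFamily F N T M) (p : ℝ≥0∞) (hp : p ≤ 1) :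
    (protocol hTN G (twoPoint hM p hp)).expectedDownload =
      (1 - p) * ENNReal.ofReal ((N : ℝ) ^ M * Real.logb 2 (Fintype.card F)) +
      p * ENNReal.ofReal
        (N * Fintype.card (Row N T (Finset.univ : Finset (Fin M)))
          * Real.logb 2 (Fintype.card F)) := by
  have hM0 : (M : ℝ≥0∞) ≠ 0 := by
    simp
    omega
  set C := Real.logb 2 (Fintype.card F)
  have key (k : Fin M) : ∑' q : Fin N → Query F N T M, queryLaw hTN G (twoPoint hM p hp) k q *
      ENNReal.ofReal (∑ l, (Fintype.card (AnsIdx (q l)) : ℝ) * C) =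
      (1 - p) * ENNReal.ofReal ((N : ℝ) ^ M * C) + p * ENNReal.ofReal
        (N * Fintype.card (Row N T (Finset.univ : Finset (Fin M))) * C) := by
    have h1 := queryLaw_twoPoint_map_apply hM hTN G p hp k id
    simp only [PMF.map_id] at h1
    simp only [h1, add_mul, mul_assoc (1 - p), mul_assoc p]
    rw [ENNReal.tsum_add, ENNReal.tsum_mul_left, ENNReal.tsum_mul_left, cleanLaw, sjLaw,
      PMF.tsum_map_mul_of_const _ _ _ (ENNReal.ofReal ((N : ℝ) ^ M * C)),
      PMF.tsum_map_mul_of_const _ _ _ (ENNReal.ofReal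
        (N * Fintype.card (Row N T (Finset.univ : Finset (Fin M))) * C))]
    · intro S
      have h2 (l : Fin N) : Fintype.card (AnsIdx (.sj Finset.univ
          (request hTN G Finset.univ k S l) : Query F N T M)) =
          Fintype.card (Row N T (Finset.univ : Finset (Fin M))) := by
        change Fintype.card (Row N T (Finset.univ : Finset (Fin M)) ×
          -- With all `M` files in use, a super-segment is a single symbol.
          Fin (N ^ (M - (Finset.univ : Finset (Fin M)).card))) = _
        have h3 : M - (Finset.univ : Finset (Fin M)).card = 0 := by simp
        rw [Fintype.card_prod, Fintype.card_fin, h3, pow_zero, mul_one]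
      simp only [h2]
      rw [Finset.sum_const, Finset.card_univ, Fintype.card_fin, nsmul_eq_mul, mul_assoc]
    · intro s
      rw [sum_card_ansIdx_clean]
  change ∑ k : Fin M, (M : ℝ≥0∞)⁻¹ * ∑' q : Fin N → Query F N T M,
    queryLaw hTN G (twoPoint hM p hp) k q *
      ENNReal.ofReal (∑ l, (Fintype.card (AnsIdx (q l)) : ℝ) * C) = _
  simp only [key]
  generalize (1 - p) * ENNReal.ofReal ((N : ℝ) ^ M * C) + p * ENNReal.ofReal
    (N * Fintype.card (Row N T (Finset.univ : Finset (Fin M))) * C) = D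
  rw [Finset.sum_const, Finset.card_univ, Fintype.card_fin, nsmul_eq_mul, ← mul_assoc,
    ENNReal.mul_inv_cancel hM0 (ENNReal.natCast_ne_top M), one_mul]

theorem rate_twoPoint [Field F] [Fintype F] [DecidableEq F] [NeZero N]
    (hM : 2 ≤ M) (hTN : T ≤ N) (G : MDSFamily F N T M) (p : ℝ) (hp0 : 0 ≤ p) (hp : ENNReal.ofReal p ≤ 1) :
    (protocol hTN G (twoPoint hM (ENNReal.ofReal p) hp)).rate =
      (1 + p * ∑ i ∈ Finset.Icc 1 (M - 1), ((T : ℝ) / N) ^ i)⁻¹ := by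
  have hp1 : p ≤ 1 := by simpa using hp
  have hN : (N : ℝ) ≠ 0 := Nat.cast_ne_zero.2 (NeZero.ne N)
  have hC : 0 < Real.logb 2 (Fintype.card F) :=
    Real.logb_pos one_lt_two (by exact_mod_cast Fintype.one_lt_card)
  have hrow : (N : ℝ) * Fintype.card (Row N T (Finset.univ : Finset (Fin M))) =
      (N : ℝ) ^ M * (1 + ∑ i ∈ Finset.Icc 1 (M - 1), ((T : ℝ) / N) ^ i) := by
    have h1 : 1 + ∑ i ∈ Finset.Icc 1 (M - 1), ((T : ℝ) / N) ^ i =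
        ∑ i ∈ Finset.range M, ((T : ℝ) / N) ^ i := by
      rw [Finset.range_eq_Ico, Finset.sum_eq_sum_Ico_succ_bot (by omega), pow_zero]
      congr 2
    rw [h1, card_row hTN, Finset.card_univ, Fintype.card_fin, ← Finset.sum_range_reflect]
    push_cast
    rw [Finset.mul_sum, Finset.mul_sum]
    refine Finset.sum_congr rfl fun i hi => ?_
    have hi := Finset.mem_range.1 hi
    have h2 : M - 1 - (M - 1 - i) = i := by omega
    have h3 : M = M - 1 - i + 1 + i := by omega
    have h4 : (N : ℝ) ^ M = N ^ (M - 1 - i) * N * N ^ i := by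
      rw [← pow_succ, ← pow_add, ← h3]
    rw [h2, h4, div_pow]
    field_simp
  have hsum : 0 ≤ ∑ i ∈ Finset.Icc 1 (M - 1), ((T : ℝ) / N) ^ i :=
    Finset.sum_nonneg fun i _ => by positivity
  unfold IRProtocol.rate
  rw [expectedDownload_twoPoint, hrow, ENNReal.toReal_add (by finiteness) (by finiteness),
    ENNReal.toReal_mul, ENNReal.toReal_mul, ENNReal.toReal_sub_of_le hp ENNReal.one_ne_top,
    ENNReal.toReal_ofReal hp0, ENNReal.toReal_ofReal (by positivity),
    ENNReal.toReal_ofReal (by positivity), ENNReal.toReal_one]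
  have hden : (1 - p) * ((N : ℝ) ^ M * Real.logb 2 (Fintype.card F)) +
      p * ((N : ℝ) ^ M * (1 + ∑ i ∈ Finset.Icc 1 (M - 1), ((T : ℝ) / N) ^ i) *
        Real.logb 2 (Fintype.card F)) = ((N : ℝ) ^ M * Real.logb 2 (Fintype.card F)) *
        (1 + p * ∑ i ∈ Finset.Icc 1 (M - 1), ((T : ℝ) / N) ^ i) := by ring
  have hpos : (N : ℝ) ^ M * Real.logb 2 (Fintype.card F) ≠ 0 :=
    mul_ne_zero (pow_ne_zero _ hN) hC.ne'
  rw [hden, Nat.cast_pow, div_mul_eq_div_div, div_self hpos, one_div]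

/-! ### Leakage -/

/-- Each chosen server has mass `1/N`. The `N - T` choices outside `𝒯` give the null view for every
file and count once; the `T` choices inside give views revealing the file and count `M` times. -/
theorem tsum_iSup_cleanLaw [NeZero N] (hM : 2 ≤ M) {𝒯 : Finset (Fin N)} (h𝒯 : 𝒯.card = T) :
    ∑' q : 𝒯 → Query F N T M, ⨆ m : Fin M, ((cleanLaw F N T M m).map fun Q (t : 𝒯) => Q t) q =
      (N - T : ℕ) * (N : ℝ≥0∞)⁻¹ + M * (T * (N : ℝ≥0∞)⁻¹) := by
  classical
  have : Nonempty (Fin M) := ⟨⟨0, by omega⟩⟩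
  let f (m : Fin M) (s : Fin N) (t : 𝒯) : Query F N T M := if t.1 = s then .clean m else .null
  let φ (q : 𝒯 → Query F N T M) (m : Fin M) : ℝ≥0∞ :=
    ∑ s ∈ 𝒯, if q = f m s then (N : ℝ≥0∞)⁻¹ else 0
  have hlaw (m : Fin M) (q : 𝒯 → Query F N T M) :
      ((cleanLaw F N T M m).map fun Q (t : 𝒯) => Q t) q =
        φ q m + ∑ s ∈ 𝒯ᶜ, if q = fun _ => .null then (N : ℝ≥0∞)⁻¹ else 0 := by
    rw [cleanLaw, PMF.map_comp, PMF.map_apply, tsum_fintype, ← Finset.sum_add_sum_compl 𝒯]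
    congr 1
    · refine Finset.sum_congr rfl fun s _ => ?_
      simp [f]
    · refine Finset.sum_congr rfl fun s hs => ?_
      have h0 : (fun t : 𝒯 => if t.1 = s then (.clean m : Query F N T M) else .null)
          = fun _ => .null := by
        ext1 t
        rw [if_neg]
        rintro rfl
        exact Finset.mem_compl.1 hs t.2
      simp [h0]
  have hsup (q : 𝒯 → Query F N T M) : ⨆ m, φ q m = ∑ m, φ q m := by
    refine iSup_eq_sum_of_pairwise _ fun m m' h h' => ?_
    obtain ⟨s, hs, h⟩ := Finset.exists_ne_zero_of_sum_ne_zero h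
    obtain ⟨s', -, h'⟩ := Finset.exists_ne_zero_of_sum_ne_zero h'
    have hq : q = f m s := by
      by_contra h0
      exact h (if_neg h0)
    have hq' : q = f m' s' := by
      by_contra h0
      exact h' (if_neg h0)
    -- At server `s` the first pattern is not null, so neither is the second, and both name the same
    -- file.
    have h1 := congrFun (hq.symm.trans hq') ⟨s, hs⟩
    simp only [f, if_true] at h1
    split_ifs at h1
    exact Query.clean.inj h1
  simp only [hlaw, ← ENNReal.iSup_add, hsup]
  have hind (x : 𝒯 → Query F N T M) :
      ∑' q, (if q = x then (N : ℝ≥0∞)⁻¹ else 0) = (N : ℝ≥0∞)⁻¹ := tsum_ite_eq _ _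
  rw [ENNReal.tsum_add, add_comm, Summable.tsum_finsetSum fun _ _ => ENNReal.summable,
    Summable.tsum_finsetSum fun _ _ => ENNReal.summable]
  simp only [φ, Summable.tsum_finsetSum fun _ _ => ENNReal.summable, hind, Finset.sum_const,
    Finset.card_compl, Fintype.card_fin, Finset.card_univ, h𝒯, nsmul_eq_mul]

theorem maxL_twoPoint [Field F] [Fintype F] [DecidableEq F] [NeZero N]
    (hM : 2 ≤ M) (hTN : T ≤ N) (G : MDSFamily F N T M) (p : ℝ) (hp0 : 0 ≤ p) (hp : ENNReal.ofReal p ≤ 1) :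
    (protocol hTN G (twoPoint hM (ENNReal.ofReal p) hp)).maxL T =
      Real.logb 2 (1 + (1 - p) * ((T : ℝ) * ((M : ℝ) - 1) / N)) := by
  have : Nonempty (Fin M) := ⟨⟨0, by omega⟩⟩
  have hp1 : p ≤ 1 := by simpa using hp
  have hN : (N : ℝ) ≠ 0 := Nat.cast_ne_zero.2 (NeZero.ne N)
  have hN' : (N : ℝ≥0∞) ≠ 0 := Nat.cast_ne_zero.2 (NeZero.ne N)
  have hset (𝒯 : Finset (Fin N)) (h𝒯 : 𝒯.card = T) :
      (protocol hTN G (twoPoint hM (ENNReal.ofReal p) hp)).setMaxL 𝒯 =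
        Real.logb 2 (1 + (1 - p) * ((T : ℝ) * ((M : ℝ) - 1) / N)) := by
    let k₀ : Fin M := ⟨0, by omega⟩
    have hq (q : 𝒯 → Query F N T M) :
        ⨆ m, ((queryLaw hTN G (twoPoint hM (ENNReal.ofReal p) hp) m).map
          fun Q (t : 𝒯) => Q t) q = (1 - ENNReal.ofReal p) *
            (⨆ m, ((cleanLaw F N T M m).map fun Q (t : 𝒯) => Q t) q) + ENNReal.ofReal p *
            ((sjLaw hTN G Finset.univ k₀).map fun Q (t : 𝒯) => Q t) q := by
      -- By privacy the Sun–Jafar term may be taken at the fixed file `k₀`; being constant in `m`,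
      -- it leaves the supremum.
      simp only [queryLaw_twoPoint_map_apply, ENNReal.mul_iSup, ENNReal.iSup_add]
      refine iSup_congr fun m => ?_
      rw [sjLaw_map_restrict hTN G (Finset.mem_univ m) (Finset.mem_univ k₀) h𝒯]
    change Real.logb 2 (∑' q : 𝒯 → Query F N T M,
      ⨆ m, ((queryLaw hTN G (twoPoint hM (ENNReal.ofReal p) hp) m).map
          fun Q (t : 𝒯) => Q t) q).toReal = _
    simp only [hq]
    rw [ENNReal.tsum_add, ENNReal.tsum_mul_left, ENNReal.tsum_mul_left, PMF.tsum_coe,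
      tsum_iSup_cleanLaw hM h𝒯, ENNReal.toReal_add (by finiteness) (by finiteness),
      ENNReal.toReal_mul, ENNReal.toReal_mul, ENNReal.toReal_sub_of_le hp ENNReal.one_ne_top,
      ENNReal.toReal_add (by finiteness) (by finiteness), ENNReal.toReal_ofReal hp0]
    simp only [ENNReal.toReal_mul, ENNReal.toReal_natCast, ENNReal.toReal_inv, ENNReal.toReal_one]
    rw [Nat.cast_sub hTN]
    congr 1
    field_simp
    ring
  -- All `T`-sets have the same leakage; one must exist, since a real supremum over an empty family
  -- would be `0`.
  obtain ⟨𝒯₀, -, h𝒯₀⟩ := Finset.exists_subset_card_eq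
    (s := (Finset.univ : Finset (Fin N))) (n := T) (by simpa using hTN)
  have : Nonempty {𝒯 : Finset (Fin N) // 𝒯.card = T} := ⟨⟨𝒯₀, h𝒯₀⟩⟩
  unfold IRProtocol.maxL
  simp only [fun 𝒯 : {𝒯 : Finset (Fin N) // 𝒯.card = T} => hset 𝒯.1 𝒯.2]
  exact ciSup_const

end TWSJ

/-! ### Choice of the mixing probability -/

theorem theorem6 (N T M : ℕ) [NeZero N] (hT : 1 ≤ T) (hTN : T ≤ N) (hM : 2 ≤ M) :
    ∃ q₀ : ℕ, ∀ (F : Type u) [Field F] [Fintype F] [DecidableEq F], q₀ ≤ Fintype.card F →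
      Nonempty (SunJafar.MDSFamily F N T M) ∧
      ∀ (G : SunJafar.MDSFamily F N T M) (ρ : ℝ), 0 ≤ ρ →
        ∃ P : PMF (Fin M),
          (∀ m : Fin M, P m ≠ 0 → m.val = 0 ∨ m.val = M - 1) ∧
          (TWSJ.protocol hTN G P).Correct ∧
          (TWSJ.protocol hTN G P).maxL T
            = min ρ (Real.logb 2 (1 + (T : ℝ) * ((M : ℝ) - 1) / N)) ∧
          (TWSJ.protocol hTN G P).rate
            = (1 + max 0 (1 - (N : ℝ) * ((2 : ℝ) ^ ρ - 1) / ((T : ℝ) * ((M : ℝ) - 1)))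
                * ∑ i ∈ Finset.Icc 1 (M - 1), ((T : ℝ) / N) ^ i)⁻¹ := by
  obtain ⟨q₀, hq₀⟩ := exists_card_imp_nonempty_MDSFamily.{u} N T M
  refine ⟨q₀, fun F _ _ _ hF => ⟨hq₀ F hF, fun G ρ hρ => ?_⟩⟩
  have hN : (0 : ℝ) < N := Nat.cast_pos.2 (NeZero.pos N)
  have hT0 : (0 : ℝ) < T := Nat.cast_pos.2 hT
  have hM0 : (0 : ℝ) < (M : ℝ) - 1 := by
    have : (2 : ℝ) ≤ M := by exact_mod_cast hM
    linarith
  have h2 : (1 : ℝ) ≤ 2 ^ ρ := Real.one_le_rpow one_le_two hρ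
  set a : ℝ := (T : ℝ) * ((M : ℝ) - 1) / N with ha
  have ha0 : 0 < a := by positivity
  have hx : (N : ℝ) * ((2 : ℝ) ^ ρ - 1) / ((T : ℝ) * ((M : ℝ) - 1)) = (2 ^ ρ - 1) / a := by
    rw [ha]
    field_simp
  rw [hx]
  -- The mixing probability solves `1 + (1 - p) a = 2 ^ ρ`, truncated at `0` when `2 ^ ρ` exceeds `1
  -- + a`, the value of a pure clean download.
  have hp0 : 0 ≤ max 0 (1 - (2 ^ ρ - 1) / a) := le_max_left _ _
  have hp1 : max 0 (1 - (2 ^ ρ - 1) / a) ≤ 1 :=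
    max_le zero_le_one (sub_le_self _ (div_nonneg (by linarith) ha0.le))
  have hp : ENNReal.ofReal (max 0 (1 - (2 ^ ρ - 1) / a)) ≤ 1 := by simpa using hp1
  refine ⟨TWSJ.twoPoint hM _ hp, TWSJ.twoPoint_ne_zero hM _ hp, TWSJ.protocol_correct hTN G _,
    ?_, TWSJ.rate_twoPoint hM hTN G _ hp0 hp⟩
  rw [TWSJ.maxL_twoPoint hM hTN G _ hp0 hp, ← ha]
  have hlog : Real.logb 2 (2 ^ ρ) = ρ := Real.logb_rpow two_pos (by norm_num)
  rcases le_total ((2 ^ ρ - 1) / a) 1 with h | h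
  · have h3 : 2 ^ ρ ≤ 1 + a := by
      rw [div_le_one ha0] at h
      linarith
    rw [max_eq_right (by linarith), min_eq_left, sub_sub_cancel, div_mul_cancel₀ _ ha0.ne',
      add_sub_cancel, hlog]
    rw [← hlog, Real.logb_le_logb one_lt_two] <;> linarith
  · have h3 : 1 + a ≤ 2 ^ ρ := by
      rw [le_div_iff₀ ha0] at h
      linarith
    rw [max_eq_left (by linarith), min_eq_right, sub_zero, one_mul]
    rw [← hlog, Real.logb_le_logb one_lt_two] <;> linarith
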